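/- An \emph{oriented cycle} is a finite directed graph $G=(V,E)$ whose underlying undirected graph is a simple cycle (so it has at least three vertices, no loops and no pair of antiparallel edges). A \emph{level assignment} is a map $\gamma:V\to\mathbb Z$ with $\gamma(u)<\gamma(v)$ for every edge $(u,v)\in E$. The graph $G$ is \emph{level planar} with respect to $\gamma$ if it has a planar drawing in the plane in which every vertex $v$ has $y$-coordinate $\gamma(v)$ and every edge $(u,v)$ is drawn as a curve whose $y$-coordinate strictly increases from $u$ to $v$. Let $S_{\min}$ be the set of sources $v$ of $G$ (vertices without incoming edges) with $\gamma(v)=\min_{u\in V}\gamma(u)$, and let $T_{\max}$ be the set of sinks $v$ of $G$ (vertices without outgoing edges) with $\gamma(v)=\max_{u\in V}\gamma(u)$. An \emph{oriented path} between two vertices $a$ and $b$ is a sequence of vertices $(v_1,\dots,v_{k+1})$, $k\ge 0$, with $v_1=a$ and $v_{k+1}=b$, such that for each $1\le i\le k$ at least one of $(v_i,v_{i+1})$, $(v_{i+1},v_i)$ is an edge. The set $T_{\max}$ is \emph{consecutive} if for all $t_1,t_2\in T_{\max}$ there is an oriented path between $t_1$ and $t_2$ that contains no vertex of $S_{\min}$.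 \textbf{Lemma.} Let $G$ be an oriented cycle with a level assignment $\gamma$. Then $G$ is level planar with respect to $\gamma$ if and only if $T_{\max}$ is consecutive. -/

import Mathlib

/-- A vertex with no incoming edges. -/
def IsSource {V : Type*} (G : Digraph V) (v : V) : Prop :=
  ∀ u, ¬ G.Adj u v

/-- A vertex with no outgoing edges. -/
def IsSink {V : Type*} (G : Digraph V) (v : V) : Prop :=
  ∀ w, ¬ G.Adj v w

/-- An oriented cycle: a directed graph whose underlying undirected graph is a simple cycle, i.e. it
has no loops and no antiparallel edges, and forgetting directions gives a cycle on `n ≥ 3`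
vertices. -/
def IsOrientedCycle {V : Type*} (G : Digraph V) : Prop :=
  (∀ u v, G.Adj u v → ¬ G.Adj v u) ∧
    ∃ n : ℕ, 3 ≤ n ∧ Nonempty (G.toSimpleGraphInclusive ≃g SimpleGraph.cycleGraph n)

/-- A level assignment: integer levels that strictly increase along every directed edge. -/
def IsLevelAssignment {V : Type*} (G : Digraph V) (γ : V → ℤ) : Prop :=
  ∀ u v, G.Adj u v → γ u < γ v

/-- The sources of minimal level. -/
def minimalSources {V : Type*} (G : Digraph V) (γ : V → ℤ) : Set V :=
  {v | IsSource G v ∧ ∀ u, γ v ≤ γ u}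

/-- The sinks of maximal level. -/
def maximalSinks {V : Type*} (G : Digraph V) (γ : V → ℤ) : Set V :=
  {v | IsSink G v ∧ ∀ u, γ u ≤ γ v}

/-- Two vertices are consecutive if some oriented path between them (a sequence of vertices in which
any two successive ones are joined by an edge in one of the two directions, that is, a walk in the
underlying undirected graph) contains no minimal source. -/
def AreConsecutive {V : Type*} (G : Digraph V) (γ : V → ℤ) (t₁ t₂ : V) : Prop :=
  ∃ p : G.toSimpleGraphInclusive.Walk t₁ t₂, ∀ v ∈ p.support, v ∉ minimalSources G γ

/-- The set of maximal sinks is consecutive: its elements are pairwise consecutive. -/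
def MaximalSinksConsecutive {V : Type*} (G : Digraph V) (γ : V → ℤ) : Prop :=
  ∀ t₁ ∈ maximalSinks G γ, ∀ t₂ ∈ maximalSinks G γ, AreConsecutive G γ t₁ t₂

/-- A planar drawing in the plane of a (loopless) directed graph: distinct vertices are distinct
points, each edge `(u, v)` is a simple curve from the point of `u` to the point of `v`, no edge
passes through a vertex other than its endpoints, and distinct edges meet only at common
endpoints. -/
structure PlanarDrawing {V : Type*} (G : Digraph V) where
  pos : V → ℝ × ℝ
  pos_injective : Function.Injective pos
  curve : ∀ {u v : V}, G.Adj u v → Path (pos u) (pos v)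
  curve_injective : ∀ {u v : V} (h : G.Adj u v), Function.Injective (curve h)
  vertex_of_curve_eq : ∀ {u v : V} (h : G.Adj u v) (w : V) (t : unitInterval),
    curve h t = pos w → w = u ∨ w = v
  common_endpoint_of_curve_eq : ∀ {u v u' v' : V} (h : G.Adj u v) (h' : G.Adj u' v')
    (s t : unitInterval), (u, v) ≠ (u', v') → curve h s = curve h' t →
      ∃ w, (w = u ∨ w = v) ∧ (w = u' ∨ w = v') ∧ curve h s = pos w

/-- A drawing is upward if along every edge, from tail to head, the `y`-coordinate is strictly
increasing. -/
def PlanarDrawing.IsUpward {V : Type*} {G : Digraph V} (D : PlanarDrawing G) : Prop :=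
  ∀ {u v : V} (h : G.Adj u v), StrictMono fun t : unitInterval => (D.curve h t).2

/-- `G` is level planar with respect to `γ`: it has an upward-planar drawing in which every vertex
`v` has `y`-coordinate `γ v`. -/
def IsLevelPlanar {V : Type*} (G : Digraph V) (γ : V → ℤ) : Prop :=
  ∃ D : PlanarDrawing G, D.IsUpward ∧ ∀ v, (D.pos v).2 = (γ v : ℝ)

/-! Necessity. If two maximal sinks `t₁`, `t₂` are not joined by a path avoiding minimal sources,
both arcs of the cycle between them contain one, so the cyclic order is `t₁, a, t₂, b` with `a`, `b`
on the bottom level. The disjoint arcs `a t₁` and `b t₂` both span the strip between the extreme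
levels, so `a`, `b` have the same left-to-right order as `t₁`, `t₂`; the disjoint arcs `a t₂` and `b
t₁` give the opposite order. That disjoint strip-spanning curves keep their order
(`Path.exists_eq_of_crossing`) is proved by following the argument of the difference of the two
curves.

Sufficiency. If the maximal sinks are consecutive, the cycle splits into two paths
(`IsCyclicEnumeration.exists_split`): one starts at the top level and never returns to it, the other
ends at the bottom level and is never there before. Draw both with straight edges and increasing
abscissas, the second far to the right of the first. The two long connecting edges are then so flat
that one passes above the left path and the other below the right path (`exists_common_endpoint`).
-/

/-! ### Disjoint curves spanning a horizontal strip -/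

/-- A continuous real function whose sine is nonnegative everywhere stays in `[0, π]` if it has one
value there. -/
theorem mem_Icc_zero_pi_of_sin_nonneg {h : ℝ → ℝ} (hc : Continuous h)
    (hs : ∀ x, 0 ≤ Real.sin (h x)) {x₀ : ℝ} (h₀ : h x₀ ∈ Set.Icc 0 Real.pi) (x : ℝ) :
    h x ∈ Set.Icc 0 Real.pi := by
  have hpi := Real.pi_pos
  constructor
  · by_contra! hx
    -- Clipping at `-π/2` makes the intermediate value land in `(-π, 0)`, where the sine is
    -- negative.
    obtain ⟨y, hy⟩ := mem_range_of_exists_le_of_exists_ge hc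
      (c := max (h x) (-(Real.pi / 2))) ⟨x, le_max_left _ _⟩
      ⟨x₀, max_le (hx.le.trans h₀.1) (by linarith [h₀.1])⟩
    have h1 := hs y
    rw [hy] at h1
    have : Real.sin (max (h x) (-(Real.pi / 2))) < 0 := by
      apply Real.sin_neg_of_neg_of_neg_pi_lt
      · exact max_lt hx (by linarith)
      · exact lt_max_of_lt_right (by linarith)
    linarith
  · by_contra! hx
    obtain ⟨y, hy⟩ := mem_range_of_exists_le_of_exists_ge hc
      (c := min (h x) (3 * Real.pi / 2)) ⟨x₀, le_min (h₀.2.trans hx.le) (by linarith [h₀.2])⟩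
      ⟨x, min_le_left _ _⟩
    have h1 := hs y
    rw [hy, ← Real.sin_pi_sub] at h1
    have : Real.sin (Real.pi - min (h x) (3 * Real.pi / 2)) < 0 := by
      apply Real.sin_neg_of_neg_of_neg_pi_lt
      · rw [sub_neg]; exact lt_min hx (by linarith)
      · have := min_le_right (h x) (3 * Real.pi / 2)
        linarith
    linarith

/-- A continuous nowhere vanishing complex function on the plane has a continuous logarithm with a
prescribed value at one point. -/
theorem exists_continuous_log {f : ℝ × ℝ → ℂ} (hf : Continuous f) (h0 : ∀ z, f z ≠ 0)
    (z₀ : ℝ × ℝ) (w₀ : ℂ) (hw : Complex.exp w₀ = f z₀) :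
    ∃ g : ℝ × ℝ → ℂ, Continuous g ∧ g z₀ = w₀ ∧ ∀ z, Complex.exp (g z) = f z := by
  have : SimplyConnectedSpace (ℝ × ℝ) := inferInstance
  have : LocallyPathConnectedSpace (ℝ × ℝ) := inferInstance
  obtain ⟨g, ⟨h1, h2⟩, -⟩ := Complex.isCoveringMapOn_exp.existsUnique_continuousMap_lifts
    ⟨f, hf⟩ (a₀ := z₀) (e₀ := w₀) hw (fun a => by simpa using h0 a)
  exact ⟨g, g.continuous, h1, fun z => congrFun h2 z⟩

/-- Two paths in a horizontal strip that lead from its lower to its upper boundary line and reverse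
the order of their endpoints have a common point. -/
theorem Path.exists_eq_of_crossing {s₁ t₁ s₂ t₂ : ℝ × ℝ} {m M : ℝ} (p : Path s₁ t₁)
    (q : Path s₂ t₂) (hp : ∀ t, (p t).2 ∈ Set.Icc m M) (hq : ∀ t, (q t).2 ∈ Set.Icc m M)
    (hs₁ : s₁.2 = m) (hs₂ : s₂.2 = m) (ht₁ : t₁.2 = M) (ht₂ : t₂.2 = M)
    (hs : s₁.1 < s₂.1) (ht : t₂.1 < t₁.1) : ∃ s t, p s = q t := by
  by_contra! hne
  have hpi := Real.pi_pos
  -- Both paths are extended to all of `ℝ`, so that their difference is defined on the whole plane,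
  -- where a logarithm exists.
  have hp' : ∀ t, (p.extend t).2 ∈ Set.Icc m M := fun t => hp _
  have hq' : ∀ t, (q.extend t).2 ∈ Set.Icc m M := fun t => hq _
  have hne' : ∀ s t, p.extend s ≠ q.extend t := fun s t => hne _ _
  have cp : Continuous p.extend := p.continuous_extend
  have cq : Continuous q.extend := q.continuous_extend
  let f : ℝ × ℝ → ℂ := fun z => Complex.equivRealProdCLM.symm (p.extend z.1 - q.extend z.2)
  have hf : Continuous f := Complex.equivRealProdCLM.symm.continuous.comp
    ((cp.comp continuous_fst).sub (cq.comp continuous_snd))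
  have f_re : ∀ z, (f z).re = (p.extend z.1).1 - (q.extend z.2).1 := fun z => by simp [f]
  have f_im : ∀ z, (f z).im = (p.extend z.1).2 - (q.extend z.2).2 := fun z => by simp [f]
  have hf0 : ∀ z, f z ≠ 0 := fun z hz => by
    have := Complex.equivRealProdCLM.symm.map_eq_zero_iff.1 hz
    exact hne' _ _ (sub_eq_zero.1 this)
  have him : (Complex.log (f (0, 0))).im = Real.pi := by
    rw [Complex.log_im, Complex.arg_eq_pi_iff]
    exact ⟨by rw [f_re]; simpa using hs, by rw [f_im]; simp [hs₁, hs₂]⟩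
  obtain ⟨g, hg, hg0, hgf⟩ := exists_continuous_log hf hf0 (0, 0) (Complex.log (f (0, 0)))
    (Complex.exp_log (hf0 _))
  have sin_nonneg : ∀ z, 0 ≤ (f z).im → 0 ≤ Real.sin (g z).im := fun z hz => by
    rw [← hgf, Complex.exp_im] at hz
    exact nonneg_of_mul_nonneg_right hz (Real.exp_pos _)
  have sin_nonneg' : ∀ z, (f z).im ≤ 0 → 0 ≤ Real.sin ((g z).im - Real.pi) := fun z hz => by
    rw [← hgf, Complex.exp_im] at hz
    rw [Real.sin_sub_pi]
    nlinarith [Real.exp_pos (g z).re]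
  -- Along the sides `(0,0)`, `(1,0)`, `(1,1)` of the parameter square the difference has
  -- nonnegative imaginary part, since `q` starts at the bottom and `p` ends at the top. The
  -- argument starts at `π` and so stays in `[0, π]`.
  have up₁ : (g (1, 0)).im ∈ Set.Icc 0 Real.pi :=
    mem_Icc_zero_pi_of_sin_nonneg (h := fun s => (g (s, 0)).im) (x₀ := 0) (by fun_prop)
      (fun s => sin_nonneg _ (by rw [f_im]; simpa [hs₂] using (hp' s).1))
      (by simp only [hg0, him]; exact ⟨hpi.le, le_rfl⟩) 1
  have up₂ : (g (1, 1)).im ∈ Set.Icc 0 Real.pi :=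
    mem_Icc_zero_pi_of_sin_nonneg (h := fun s => (g (1, s)).im) (x₀ := 0) (by fun_prop)
      (fun s => sin_nonneg _ (by rw [f_im]; simpa [ht₁] using (hq' s).2)) up₁ 1
  -- Along the other two sides the imaginary part is nonpositive, which confines the argument to
  -- `[π, 2π]`.
  have low₁ : (g (0, 1)).im - Real.pi ∈ Set.Icc 0 Real.pi :=
    mem_Icc_zero_pi_of_sin_nonneg (h := fun s => (g (0, s)).im - Real.pi) (x₀ := 0) (by fun_prop)
      (fun s => sin_nonneg' _ (by rw [f_im]; simpa [hs₁] using (hq' s).1))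
      (by simp only [hg0, him, sub_self]; exact ⟨le_rfl, hpi.le⟩) 1
  have low₂ : (g (1, 1)).im - Real.pi ∈ Set.Icc 0 Real.pi :=
    mem_Icc_zero_pi_of_sin_nonneg (h := fun s => (g (s, 1)).im - Real.pi) (x₀ := 0) (by fun_prop)
      (fun s => sin_nonneg' _ (by rw [f_im]; simpa [ht₂] using (hp' s).2)) low₁ 1
  -- The two routes agree only at `π`, so the difference at `(1,1)` is a negative real, against
  -- `ht`.
  have hpi' : (g (1, 1)).im = Real.pi := le_antisymm up₂.2 (by linarith [low₂.1])
  have hre : (f (1, 1)).re = t₁.1 - t₂.1 := by rw [f_re]; simp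
  rw [← hgf, Complex.exp_re, hpi', Real.cos_pi] at hre
  linarith [Real.exp_pos (g (1, 1)).re]

/-- Two disjoint sets in a horizontal strip that join its lower to its upper boundary line do so in
the same left-to-right order. -/
theorem JoinedIn.not_crossing {A B : Set (ℝ × ℝ)} {s₁ t₁ s₂ t₂ : ℝ × ℝ} {m M : ℝ}
    (hA : JoinedIn A s₁ t₁) (hB : JoinedIn B s₂ t₂) (hAB : Disjoint A B)
    (hmA : ∀ z ∈ A, z.2 ∈ Set.Icc m M) (hmB : ∀ z ∈ B, z.2 ∈ Set.Icc m M)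
    (hs₁ : s₁.2 = m) (hs₂ : s₂.2 = m) (ht₁ : t₁.2 = M) (ht₂ : t₂.2 = M)
    (hs : s₁.1 < s₂.1) : t₁.1 < t₂.1 := by
  have hne : t₁ ≠ t₂ := fun h => hAB.ne_of_mem hA.target_mem hB.target_mem h
  by_contra! ht
  have ht' : t₂.1 < t₁.1 := lt_of_le_of_ne ht fun h => hne (Prod.ext h.symm (ht₁.trans ht₂.symm))
  obtain ⟨s, t, h⟩ := Path.exists_eq_of_crossing hA.somePath hB.somePath
    (fun t => hmA _ (hA.somePath_mem t)) (fun t => hmB _ (hB.somePath_mem t)) hs₁ hs₂ ht₁ ht₂ hs ht'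
  exact hAB.ne_of_mem (hA.somePath_mem s) (hB.somePath_mem t) h

/-! ### Periodic enumerations of a cycle -/

/-- `v` runs through the vertices of the graph `H`, a cycle with `n` vertices, again and again. -/
structure IsCyclicEnumeration {V : Type*} (H : SimpleGraph V) (n : ℕ) (v : ℕ → V) : Prop where
  adj_succ : ∀ i, H.Adj (v i) (v (i + 1))
  eq_iff : ∀ i j, v i = v j ↔ i ≡ j [MOD n]
  surjective : Function.Surjective v
  exists_of_adj : ∀ x y, H.Adj x y → ∃ i, s(x, y) = s(v i, v (i + 1))

theorem exists_isCyclicEnumeration {V : Type*} {H : SimpleGraph V} {n : ℕ} (hn : 2 ≤ n)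
    (e : H ≃g SimpleGraph.cycleGraph n) : ∃ v : ℕ → V, IsCyclicEnumeration H n v := by
  obtain ⟨k, rfl⟩ := Nat.exists_eq_add_of_le' hn
  have succ : ∀ i, Fin.ofNat (k + 2) (i + 1) = Fin.ofNat (k + 2) i + 1 := fun i =>
    Fin.ext (by simp [Fin.val_add])
  have val : ∀ a : Fin (k + 2), Fin.ofNat (k + 2) a.val = a := fun a =>
    Fin.ext (Nat.mod_eq_of_lt a.isLt)
  refine ⟨fun i => e.symm (Fin.ofNat (k + 2) i), fun i => ?_, fun i j => ?_, fun w => ?_, ?_⟩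
  · rw [e.symm.map_adj_iff, SimpleGraph.cycleGraph_adj, succ]
    exact Or.inr (add_sub_cancel_left _ _)
  · rw [e.symm.injective.eq_iff, Fin.ext_iff]
    rfl
  · exact ⟨(e w).val, by simp only [val, RelIso.symm_apply_apply]⟩
  · intro x y hxy
    rw [← e.map_adj_iff, SimpleGraph.cycleGraph_adj] at hxy
    rcases hxy with h | h
    · refine ⟨(e y).val, ?_⟩
      have : e y + 1 = e x := by rw [← h]; exact add_sub_cancel _ _
      simp only [succ, val, this, RelIso.symm_apply_apply]
      exact Sym2.eq_swap
    · refine ⟨(e x).val, ?_⟩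
      have : e x + 1 = e y := by rw [← h]; exact add_sub_cancel _ _
      simp only [succ, val, this, RelIso.symm_apply_apply]

namespace IsCyclicEnumeration

variable {V : Type*} {H : SimpleGraph V} {n : ℕ} {v : ℕ → V}

/-- Allows any chosen vertex to get index `0`; arcs then become intervals of natural numbers, with
`v n = v 0` closing the cycle. -/
theorem shift (hv : IsCyclicEnumeration H n v) (hn : n ≠ 0) (r : ℕ) :
    IsCyclicEnumeration H n fun i => v (i + r) := by
  -- The index `i - r` is raised by the multiple `r * n` of the period to avoid truncated
  -- subtraction.
  have hper : ∀ i, ∃ j, v (j + r) = v i ∧ v (j + 1 + r) = v (i + 1) := fun i => by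
    have : i + r * n - r + r = i + r * n :=
      Nat.sub_add_cancel (le_add_left (Nat.le_mul_of_pos_right r (Nat.pos_of_ne_zero hn)))
    refine ⟨i + r * n - r, ?_, ?_⟩
    · rw [this, hv.eq_iff]
      simp [Nat.ModEq]
    · rw [add_right_comm, this, add_right_comm, hv.eq_iff]
      simp [Nat.ModEq]
  refine ⟨fun i => ?_, fun i j => ?_, fun w => ?_, fun x y hxy => ?_⟩
  · rw [add_right_comm]
    exact hv.adj_succ _
  · rw [hv.eq_iff]
    exact ⟨Nat.ModEq.add_right_cancel' r, fun h => h.add_right r⟩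
  · obtain ⟨i, rfl⟩ := hv.surjective w
    obtain ⟨j, hj, -⟩ := hper i
    exact ⟨j, hj⟩
  · obtain ⟨i, hi⟩ := hv.exists_of_adj x y hxy
    obtain ⟨j, hj, hj'⟩ := hper i
    exact ⟨j, by rw [hj, hj', hi]⟩

theorem injOn (hv : IsCyclicEnumeration H n v) {i j : ℕ} (hi : i < n) (hj : j < n)
    (h : v i = v j) : i = j :=
  Nat.ModEq.eq_of_lt_of_lt ((hv.eq_iff i j).1 h) hi hj

theorem ne_of_lt (hv : IsCyclicEnumeration H n v) {i j : ℕ} (hij : i < j) (hj : j < i + n) :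
    v i ≠ v j := fun h => by
  have := (Nat.modEq_iff_dvd' hij.le).1 ((hv.eq_iff i j).1 h)
  have := Nat.le_of_dvd (by omega) this
  omega

theorem apply_card (hv : IsCyclicEnumeration H n v) : v n = v 0 :=
  (hv.eq_iff n 0).2 (by simp [Nat.ModEq])

theorem exists_lt (hv : IsCyclicEnumeration H n v) (hn : n ≠ 0) (w : V) : ∃ i < n, v i = w := by
  obtain ⟨i, rfl⟩ := hv.surjective w
  exact ⟨i % n, Nat.mod_lt _ (Nat.pos_of_ne_zero hn), (hv.eq_iff _ _).2 (Nat.mod_modEq i n)⟩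

theorem exists_lt_of_adj (hv : IsCyclicEnumeration H n v) (hn : n ≠ 0) {x y : V}
    (h : H.Adj x y) : ∃ i < n, s(x, y) = s(v i, v (i + 1)) := by
  obtain ⟨i, hi⟩ := hv.exists_of_adj x y h
  refine ⟨i % n, Nat.mod_lt _ (Nat.pos_of_ne_zero hn), ?_⟩
  rw [hi, (hv.eq_iff (i % n) i).2 (Nat.mod_modEq i n),
    (hv.eq_iff (i % n + 1) (i + 1)).2 ((Nat.mod_modEq i n).add_right 1)]

/-- The walk along an enumerated cycle. -/
theorem exists_walk (hv : IsCyclicEnumeration H n v) {i j : ℕ} (hij : i ≤ j) :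
    ∃ p : H.Walk (v i) (v j), ∀ w ∈ p.support, ∃ k, i ≤ k ∧ k ≤ j ∧ w = v k := by
  induction j, hij using Nat.le_induction with
  | base => exact ⟨.nil, fun w hw => ⟨i, le_rfl, le_rfl, by simpa using hw⟩⟩
  | succ j hij ih =>
    obtain ⟨p, hp⟩ := ih
    refine ⟨p.append (.cons (hv.adj_succ j) .nil), fun w hw => ?_⟩
    rw [SimpleGraph.Walk.mem_support_append_iff] at hw
    rcases hw with hw | hw
    · obtain ⟨k, h1, h2, h3⟩ := hp w hw
      exact ⟨k, h1, by omega, h3⟩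
    · simp only [SimpleGraph.Walk.support_cons, SimpleGraph.Walk.support_nil, List.mem_cons,
        List.not_mem_nil, or_false] at hw
      rcases hw with rfl | rfl
      · exact ⟨j, hij, by omega, rfl⟩
      · exact ⟨j + 1, by omega, le_rfl, rfl⟩

/-- A walk in a cycle that avoids two vertices stays on one side of them. -/
theorem walk_between (hv : IsCyclicEnumeration H n v) {s : ℕ} (hs : s < n) {x y : V}
    (p : H.Walk x y) (h0 : v 0 ∉ p.support) (h1 : v s ∉ p.support)
    (hx : ∃ i, 0 < i ∧ i < s ∧ x = v i) : ∃ i, 0 < i ∧ i < s ∧ y = v i := by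
  induction p with
  | nil => exact hx
  | @cons x z y hxz p ih =>
    rw [SimpleGraph.Walk.support_cons, List.mem_cons, not_or] at h0 h1
    refine ih h0.2 h1.2 ?_
    obtain ⟨i, hi0, his, rfl⟩ := hx
    have hz0 : z ≠ v 0 := fun h => h0.2 (h ▸ p.start_mem_support)
    have hzs : z ≠ v s := fun h => h1.2 (h ▸ p.start_mem_support)
    obtain ⟨j, hj, hij⟩ := hv.exists_lt_of_adj (by omega) hxz
    rw [Sym2.eq_iff] at hij
    rcases hij with ⟨h, h'⟩ | ⟨h, h'⟩
    · obtain rfl := hv.injOn (by omega) hj h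
      refine ⟨i + 1, by omega, lt_of_le_of_ne (by omega) ?_, h'⟩
      rintro rfl
      exact hzs h'
    · have hjn : j + 1 < n := by
        by_contra hlt
        obtain rfl : n = j + 1 := by omega
        rw [hv.apply_card] at h
        exact hv.ne_of_lt hi0 (by omega) h.symm
      obtain rfl := hv.injOn (by omega) hjn h
      refine ⟨j, Nat.pos_of_ne_zero ?_, by omega, h'⟩
      rintro rfl
      exact hz0 h'

end IsCyclicEnumeration

/-! ### Arcs of a drawn cycle, and necessity -/

namespace PlanarDrawing

variable {V : Type*} {G : Digraph V}

/-- The points on the curves of the edges between the successive vertices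
`v i, v (i + 1), …, v j`. -/
def arc (D : PlanarDrawing G) (v : ℕ → V) (i j : ℕ) : Set (ℝ × ℝ) :=
  {z | ∃ k, i ≤ k ∧ k < j ∧ ∃ (x y : V) (h : G.Adj x y) (t : unitInterval),
    s(x, y) = s(v k, v (k + 1)) ∧ D.curve h t = z}

/-- Edges may point against the enumeration, which does no harm as `JoinedIn` is symmetric. The
inequality is strict because `D.arc v i i` is empty. -/
theorem joinedIn_arc (D : PlanarDrawing G) {n : ℕ} {v : ℕ → V}
    (hv : IsCyclicEnumeration G.toSimpleGraphInclusive n v) {i j : ℕ} (hij : i < j) :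
    JoinedIn (D.arc v i j) (D.pos (v i)) (D.pos (v j)) := by
  have step : ∀ k, i ≤ k → k < j → JoinedIn (D.arc v i j) (D.pos (v k)) (D.pos (v (k + 1))) := by
    intro k hik hkj
    have hadj := hv.adj_succ k
    rw [Digraph.toSimpleGraphInclusive, SimpleGraph.fromRel_adj] at hadj
    rcases hadj with ⟨-, h | h⟩
    · exact ⟨D.curve h, fun t => ⟨k, hik, hkj, _, _, h, t, rfl, rfl⟩⟩
    · exact JoinedIn.symm ⟨D.curve h, fun t => ⟨k, hik, hkj, _, _, h, t, Sym2.eq_swap, rfl⟩⟩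
  have main : ∀ k, i + 1 ≤ k → k ≤ j → JoinedIn (D.arc v i j) (D.pos (v i)) (D.pos (v k)) := by
    intro k hik
    induction k, hik using Nat.le_induction with
    | base => exact fun _ => step i le_rfl hij
    | succ k hik ih => exact fun hkj => (ih (by omega)).trans (step k (by omega) (by omega))
  exact main j hij le_rfl

/-- Both index ranges lie within one period, so the arcs share no vertex, while a common point of
two distinct edges would be a common endpoint. -/
theorem disjoint_arc (D : PlanarDrawing G) {n : ℕ} {v : ℕ → V}
    (hv : IsCyclicEnumeration G.toSimpleGraphInclusive n v) {i j k l : ℕ} (hjk : j < k)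
    (hl : l < i + n) : Disjoint (D.arc v i j) (D.arc v k l) := by
  rw [Set.disjoint_left]
  rintro z ⟨a, hia, haj, x, y, h, t, hxy, hz⟩ ⟨b, hkb, hbl, x', y', h', t', hxy', hz'⟩
  have key : ∀ w, ¬ ((w = x ∨ w = y) ∧ (w = x' ∨ w = y')) := by
    rintro w ⟨h1, h2⟩
    rw [← Sym2.mem_iff, hxy, Sym2.mem_iff] at h1
    rw [← Sym2.mem_iff, hxy', Sym2.mem_iff] at h2
    have ne : ∀ c d, i ≤ c → c ≤ j → k ≤ d → d ≤ l → v c ≠ v d := fun c d _ _ _ _ =>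
      hv.ne_of_lt (by omega) (by omega)
    rcases h1 with rfl | rfl <;> rcases h2 with h2 | h2 <;>
      exact ne _ _ (by omega) (by omega) (by omega) (by omega) h2
  obtain ⟨w, h1, h2, -⟩ := D.common_endpoint_of_curve_eq h h' t t' (fun he => by
    rw [Prod.mk.injEq] at he
    exact key x ⟨Or.inl rfl, Or.inl he.1⟩) (hz.trans hz'.symm)
  exact key w ⟨h1, h2⟩

theorem mem_Icc_of_mem_arc (D : PlanarDrawing G) (hD : D.IsUpward) {m M : ℝ}
    (hm : ∀ x, (D.pos x).2 ∈ Set.Icc m M) {v : ℕ → V} {i j : ℕ} :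
    ∀ z ∈ D.arc v i j, z.2 ∈ Set.Icc m M := by
  rintro z ⟨a, -, -, x, y, h, t, -, rfl⟩
  have h0 := (hD h).monotone (unitInterval.nonneg' (t := t))
  have h1 := (hD h).monotone (unitInterval.le_one' (t := t))
  simp only [Path.source, Path.target] at h0 h1
  exact ⟨(hm x).1.trans h0, h1.trans (hm y).2⟩

end PlanarDrawing

theorem maximalSinksConsecutive_of_isLevelPlanar {V : Type*} {G : Digraph V} {γ : V → ℤ}
    (hG : IsOrientedCycle G) (hP : IsLevelPlanar G γ) : MaximalSinksConsecutive G γ := by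
  obtain ⟨-, n, hn, ⟨e⟩⟩ := hG
  obtain ⟨D, hD, hpos⟩ := hP
  obtain ⟨v', hv'⟩ := exists_isCyclicEnumeration (by omega) e
  intro x hx y hy
  obtain ⟨v, hv, rfl⟩ : ∃ v, IsCyclicEnumeration G.toSimpleGraphInclusive n v ∧ v 0 = x := by
    obtain ⟨r, rfl⟩ := hv'.surjective x
    exact ⟨_, hv'.shift (by omega) r, by simp⟩
  obtain ⟨q, hqn, rfl⟩ := hv.exists_lt (by omega) y
  by_contra hcon
  -- Every vertex of the cycle has an incident edge, so none is both a sink and a source.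
  have hdisj : ∀ w ∈ maximalSinks G γ, w ∉ minimalSources G γ := by
    intro w hw hw'
    obtain ⟨i, rfl⟩ := hv.surjective w
    have hadj := hv.adj_succ i
    rw [Digraph.toSimpleGraphInclusive, SimpleGraph.fromRel_adj] at hadj
    rcases hadj with ⟨-, h | h⟩
    · exact hw.1 _ h
    · exact hw'.1 _ h
  have hq0 : q ≠ 0 := by
    rintro rfl
    exact hcon ⟨.nil, by simpa using hdisj _ hx⟩
  obtain ⟨a, ha0, haq, ha⟩ : ∃ a, 0 < a ∧ a < q ∧ v a ∈ minimalSources G γ := by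
    obtain ⟨p, hp⟩ := hv.exists_walk (Nat.zero_le q)
    by_contra! hno
    refine hcon ⟨p, fun w hw hws => ?_⟩
    obtain ⟨k, -, hkq, rfl⟩ := hp w hw
    rcases Nat.eq_zero_or_pos k with rfl | hk0
    · exact hdisj _ hx hws
    rcases hkq.eq_or_lt with rfl | hkq
    · exact hdisj _ hy hws
    · exact hno k hk0 hkq hws
  obtain ⟨b, hqb, hbn, hb⟩ : ∃ b, q < b ∧ b < n ∧ v b ∈ minimalSources G γ := by
    obtain ⟨p, hp⟩ := hv.exists_walk hqn.le
    by_contra! hno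
    refine hcon ⟨p.reverse.copy hv.apply_card rfl, fun w hw hws => ?_⟩
    rw [SimpleGraph.Walk.support_copy, SimpleGraph.Walk.support_reverse, List.mem_reverse] at hw
    obtain ⟨k, hqk, hkn, rfl⟩ := hp w hw
    rcases hqk.eq_or_lt with rfl | hqk
    · exact hdisj _ hy hws
    rcases hkn.eq_or_lt with rfl | hkn
    · exact hdisj _ hx (hv.apply_card ▸ hws)
    · exact hno k hqk hkn hws
  have hm : ∀ w, (D.pos w).2 ∈ Set.Icc (γ (v a) : ℝ) (γ (v 0)) := fun w => by
    rw [hpos]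
    exact ⟨by exact_mod_cast ha.2 w, by exact_mod_cast hx.2 w⟩
  have hya : (D.pos (v a)).2 = (γ (v a) : ℝ) := hpos _
  have hyb : (D.pos (v b)).2 = (γ (v a) : ℝ) := by
    rw [hpos, le_antisymm (hb.2 (v a)) (ha.2 (v b))]
  have hy0 : (D.pos (v 0)).2 = (γ (v 0) : ℝ) := hpos _
  have hyq : (D.pos (v q)).2 = (γ (v 0) : ℝ) := by
    rw [hpos, le_antisymm (hx.2 (v q)) (hy.2 (v 0))]
  -- The four arcs between `0 < a < q < b < n`; opposite ones are disjoint. `J₁`, `J₂` and `J₃`,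
  -- `J₄` match the bottom vertices with the top ones in the two possible ways.
  have J₁ := (D.joinedIn_arc hv ha0).symm
  have J₂ := (D.joinedIn_arc hv hqb).symm
  have J₃ := D.joinedIn_arc hv haq
  have J₄ := D.joinedIn_arc hv hbn
  rw [hv.apply_card] at J₄
  have d₁ := D.disjoint_arc hv haq (l := b) (i := 0) (by omega)
  have d₂ := D.disjoint_arc hv hqb (l := n) (i := a) (by omega)
  have strip : ∀ i j, ∀ z ∈ D.arc v i j, z.2 ∈ Set.Icc (γ (v a) : ℝ) (γ (v 0)) :=
    fun i j => D.mem_Icc_of_mem_arc hD hm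
  have hne : (D.pos (v a)).1 ≠ (D.pos (v b)).1 := fun h =>
    hv.ne_of_lt (by omega : a < b) (by omega) (D.pos_injective (Prod.ext h (hya.trans hyb.symm)))
  rcases hne.lt_or_gt with h | h
  · have h1 := J₁.not_crossing J₂ d₁ (strip _ _) (strip _ _) hya hyb hy0 hyq h
    have h2 := J₃.not_crossing J₄ d₂ (strip _ _) (strip _ _) hya hyb hyq hy0 h
    exact lt_asymm h1 h2
  · have h1 := J₂.not_crossing J₁ d₁.symm (strip _ _) (strip _ _) hyb hya hyq hy0 h
    have h2 := J₄.not_crossing J₃ d₂.symm (strip _ _) (strip _ _) hyb hya hy0 hyq h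
    exact lt_asymm h1 h2

/-! ### Splitting the cycle -/

/-- Rotate an enumeration of a cycle so that it starts in `T` and splits into a part without
elements of `S` and a part without elements of `T`. -/
theorem IsCyclicEnumeration.exists_split {V : Type*} {H : SimpleGraph V} {n : ℕ} {v : ℕ → V}
    (hv : IsCyclicEnumeration H n v) (hn : n ≠ 0) {S T : Set V} (hS : S.Nonempty)
    (hT : T.Nonempty) (hST : ∀ x ∈ T, x ∉ S)
    (hwalk : ∀ x ∈ T, ∀ y ∈ T, ∃ p : H.Walk x y, ∀ w ∈ p.support, w ∉ S) :
    ∃ v' k, IsCyclicEnumeration H n v' ∧ 0 < k ∧ k < n ∧ v' 0 ∈ T ∧ v' k ∈ S ∧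
      (∀ i < k, v' i ∉ S) ∧ ∀ i, k ≤ i → i < n → v' i ∉ T := by
  classical
  obtain ⟨v, hv, hv0⟩ : ∃ v, IsCyclicEnumeration H n v ∧ v 0 ∈ S := by
    obtain ⟨s, hs⟩ := hS
    obtain ⟨r, rfl⟩ := hv.surjective s
    exact ⟨_, hv.shift hn r, by simpa using hs⟩
  have hTex : ∃ i, v i ∈ T := by
    obtain ⟨t, ht⟩ := hT
    obtain ⟨i, rfl⟩ := hv.surjective t
    exact ⟨i, ht⟩
  -- With `v 0 ∈ S`, let `p` be the first index in `T` and `s` the next one in `S`; the rotated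
  -- enumeration starts at `p`.
  obtain ⟨p, hp, hpmin⟩ : ∃ p, v p ∈ T ∧ ∀ i < p, v i ∉ T :=
    ⟨Nat.find hTex, Nat.find_spec hTex, fun i hi => Nat.find_min hTex hi⟩
  have hp0 : 0 < p := Nat.pos_of_ne_zero fun h => hST _ hp (h ▸ hv0)
  have hpn : p < n := by
    obtain ⟨i, hi, hip⟩ := hv.exists_lt hn (v p)
    by_contra hlt
    exact hpmin i (by omega) (hip ▸ hp)
  have hSex : ∃ j, p < j ∧ v j ∈ S := ⟨n, hpn, by rwa [hv.apply_card]⟩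
  obtain ⟨s, hps, hs, hsmin⟩ : ∃ s, p < s ∧ v s ∈ S ∧ ∀ j, p < j → j < s → v j ∉ S :=
    ⟨Nat.find hSex, (Nat.find_spec hSex).1, (Nat.find_spec hSex).2,
      fun j hj hjs hjS => Nat.find_min hSex hjs ⟨hj, hjS⟩⟩
  have hsn : s ≤ n := by
    by_contra hlt
    exact hsmin n hpn (by omega) (by rwa [hv.apply_card])
  refine ⟨_, s - p, hv.shift hn p, by omega, by omega, by simpa using hp, ?_, ?_, ?_⟩
  · rwa [Nat.sub_add_cancel hps.le]
  · intro i hi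
    rcases Nat.eq_zero_or_pos i with rfl | hi0
    · simpa using hST _ hp
    · exact hsmin _ (by omega) (by omega)
  · intro i hi hin hiT
    rcases lt_or_ge (i + p) n with hlt | hge
    -- A walk from `v p` avoiding `S` cannot pass `v 0` or `v s`, so it never reaches an index in
    -- `[s, n)`.
    · obtain ⟨w, hw⟩ := hwalk _ hp _ hiT
      obtain ⟨j, hj0, hjs, hj⟩ := hv.walk_between (by omega : s < n) w
        (fun h => hw _ h hv0) (fun h => hw _ h hs) ⟨p, hp0, hps, rfl⟩
      have := hv.injOn hlt (by omega) hj
      omega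
    -- After wrapping around, the index is below `p`, against the minimality of `p`.
    · have : v (i + p) = v (i + p - n) := by
        rw [hv.eq_iff, Nat.ModEq.comm, Nat.modEq_iff_dvd' (by omega)]
        rw [Nat.sub_sub_self hge]
      simp only [this] at hiT
      exact hpmin _ (by omega) hiT

/-! ### Straight-line drawings -/

/-- If a line separates two segments and meets the first one at most in an endpoint, then this
endpoint is the only possible common point. -/
theorem eq_of_mem_segment_of_separated {A B C D z : ℝ × ℝ} {α β c : ℝ}
    (hA : α * A.1 + β * A.2 ≤ c) (hB : α * B.1 + β * B.2 < c)
    (hC : c ≤ α * C.1 + β * C.2) (hD : c ≤ α * D.1 + β * D.2)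
    (h : z ∈ segment ℝ A B) (h' : z ∈ segment ℝ C D) :
    z = A ∧ α * A.1 + β * A.2 = c := by
  obtain ⟨s, t, hs, ht, hst, rfl⟩ := h
  obtain ⟨s', t', hs', ht', hst', hz⟩ := h'
  have h1 := congrArg Prod.fst hz
  have h2 := congrArg Prod.snd hz
  simp only [Prod.fst_add, Prod.snd_add, Prod.smul_fst, Prod.smul_snd, smul_eq_mul] at h1 h2
  have key : α * (s * A.1 + t * B.1) + β * (s * A.2 + t * B.2) ≥ c := by
    rw [← h1, ← h2]
    have e1 := mul_le_mul_of_nonneg_left hC hs'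
    have e2 := mul_le_mul_of_nonneg_left hD ht'
    have : c = s' * c + t' * c := by rw [← add_mul, hst', one_mul]
    linarith
  have e1 := mul_le_mul_of_nonneg_left hA hs
  have hc : c = s * c + t * c := by rw [← add_mul, hst, one_mul]
  have ht0 : t = 0 := by
    by_contra hne
    have e2 := mul_lt_mul_of_pos_left hB (lt_of_le_of_ne ht (Ne.symm hne))
    linarith
  obtain rfl : s = 1 := by linarith
  subst ht0
  refine ⟨by simp, le_antisymm hA (by linarith)⟩

/-- Straight-line drawings of a digraph are level drawings as soon as the segments of different
edges meet at common endpoints only. -/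
theorem isLevelPlanar_of_segments {V : Type*} {G : Digraph V} {γ : V → ℤ}
    (hγ : IsLevelAssignment G γ) (hnbr : ∀ x, ∃ y, G.toSimpleGraphInclusive.Adj x y)
    (pos : V → ℝ × ℝ) (hinj : Function.Injective pos) (hpos : ∀ x, (pos x).2 = (γ x : ℝ))
    (hseg : ∀ x y x' y', G.toSimpleGraphInclusive.Adj x y → G.toSimpleGraphInclusive.Adj x' y' →
      s(x, y) ≠ s(x', y') → ∀ z ∈ segment ℝ (pos x) (pos y), z ∈ segment ℝ (pos x') (pos y') →
      ∃ w, (w = x ∨ w = y) ∧ (w = x' ∨ w = y') ∧ z = pos w) : IsLevelPlanar G γ := by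
  have hadj : ∀ {x y}, G.Adj x y → G.toSimpleGraphInclusive.Adj x y := fun {x y} h => by
    rw [Digraph.toSimpleGraphInclusive, SimpleGraph.fromRel_adj]
    exact ⟨fun he => (hγ x y h).ne (he ▸ rfl), Or.inl h⟩
  have hmem : ∀ x y (t : unitInterval),
      AffineMap.lineMap (pos x) (pos y) (t : ℝ) ∈ segment ℝ (pos x) (pos y) := fun x y t => by
    rw [segment_eq_image_lineMap]
    exact ⟨t, t.2, rfl⟩
  let D : PlanarDrawing G :=
    { pos := pos
      pos_injective := hinj
      curve := fun {x y} _ => Path.segment (pos x) (pos y)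
      curve_injective := fun {x y} h => Path.segment_injective_of_ne (hinj.ne (hadj h).ne)
      vertex_of_curve_eq := fun {x y} h w t hw => by
        -- As `w` is an endpoint of some edge, a vertex lying on an edge is a case of two edges
        -- meeting.
        obtain ⟨w', hw'⟩ := hnbr w
        by_cases he : s(x, y) = s(w, w')
        · rw [← Sym2.mem_iff, he]
          exact Sym2.mem_mk_left w w'
        · obtain ⟨c, hc, -, hwc⟩ := hseg x y w w' (hadj h) hw' he (pos w) (hw ▸ hmem x y t)
            (left_mem_segment ℝ _ _)
          rwa [hinj hwc]
      common_endpoint_of_curve_eq := fun {x y x' y'} h h' s t hne hst => by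
        refine hseg x y x' y' (hadj h) (hadj h') (fun he => ?_) _ (hmem x y s) ?_
        · rcases Sym2.eq_iff.1 he with ⟨rfl, rfl⟩ | ⟨rfl, rfl⟩
          · exact hne rfl
          · exact lt_asymm (hγ _ _ h) (hγ _ _ h')
        · exact (congrArg (· ∈ segment ℝ (pos x') (pos y')) hst).mpr (hmem x' y' t) }
  refine ⟨D, fun {x y} h s t hst => ?_, hpos⟩
  have hlt : (γ x : ℝ) < γ y := by exact_mod_cast hγ x y h
  have hs : ∀ t : unitInterval, (D.curve h t).2 = AffineMap.lineMap (γ x : ℝ) (γ y) (t : ℝ) :=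
    fun t => by
      rw [← hpos, ← hpos]
      exact AffineMap.snd_lineMap ..
  simp only [hs]
  exact (lineMap_lt_lineMap_iff_of_lt' hlt).2 hst

/-! ### The drawing with two distant paths, and sufficiency -/

/-- The edges of a cycle on `0, …, n - 1` that consists of the paths `0, …, a` and
`a + 1, …, n - 1` and of two edges that join their first and their last vertices. -/
def IsTwoPathEdge (n a i j : ℕ) : Prop :=
  (j = i + 1 ∧ j < n ∧ i ≠ a) ∨ (i = 0 ∧ j = a + 1) ∨ (i = a ∧ j + 1 = n)

/-- Abscissas of two groups of points, `0, …, a` and `a + 1, …`, with a gap `K` between them. -/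
noncomputable def gapAbscissa (a : ℕ) (K : ℝ) (i : ℕ) : ℝ :=
  if i ≤ a then i else i + K

theorem gapAbscissa_strictMono (a : ℕ) {K : ℝ} (hK : 0 ≤ K) : StrictMono (gapAbscissa a K) := by
  intro i j hij
  have : (i : ℝ) < j := by exact_mod_cast hij
  unfold gapAbscissa
  split_ifs
  · exact this
  · linarith
  · omega
  · linarith

/-- The two paths, the first of which starts on the top level `M` and then stays below `M - 1`, and
the second of which ends on the bottom level `m` after having stayed above `m + 1`, and the two long
edges between their ends do not cross when the two paths are far apart. -/
theorem exists_common_endpoint {n a : ℕ} (hn : 3 ≤ n) (ha : a + 2 ≤ n) {Y : ℕ → ℝ} {m M : ℝ}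
    (hY : ∀ i < n, Y i ∈ Set.Icc m M) (h0 : Y 0 = M) (hlast : ∀ i, i + 1 = n → Y i = m)
    (hleft : ∀ i, 0 < i → i ≤ a → Y i ≤ M - 1)
    (hright : ∀ i, a < i → i + 1 < n → m + 1 ≤ Y i) {P : ℕ → ℝ × ℝ}
    (hP : ∀ i, P i = (gapAbscissa a ((M - m) * n) i, Y i)) {i j i' j' : ℕ}
    (he : IsTwoPathEdge n a i j) (he' : IsTwoPathEdge n a i' j') (hne : (i, j) ≠ (i', j'))
    {z : ℝ × ℝ} (hz : z ∈ segment ℝ (P i) (P j)) (hz' : z ∈ segment ℝ (P i') (P j')) :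
    ∃ c, (c = i ∨ c = j) ∧ (c = i' ∨ c = j') ∧ z = P c := by
  have hmM : 0 ≤ M - m := by have := hY 0 (by omega); linarith [this.1, this.2]
  have hK : 0 ≤ (M - m) * n := by positivity
  have hX := gapAbscissa_strictMono a hK
  set X := gapAbscissa a ((M - m) * n) with hXdef
  have hbound : ∀ i : ℕ, i ≤ n → (M - m) * i ≤ (M - m) * n := fun i hi =>
    mul_le_mul_of_nonneg_left (by exact_mod_cast hi) hmM
  have Xl : ∀ i ≤ a, X i = i := fun i hi => by simp [X, gapAbscissa, hi]
  have Xr : ∀ i, a < i → X i = i + (M - m) * n := fun i hi => by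
    simp [X, gapAbscissa, Nat.not_le.2 hi]
  have P1 : ∀ i, (P i).1 = X i := fun i => by rw [hP]
  have P2 : ∀ i, (P i).2 = Y i := fun i => by rw [hP]
  have lt_of_edge : ∀ {i j}, IsTwoPathEdge n a i j → i < j := by
    rintro i j (h | h | h) <;> omega
  -- edges whose ranges of abscissas do not overlap
  have apart : ∀ {i j i' j' : ℕ}, i < j → i' < j' → j ≤ i' → z ∈ segment ℝ (P i) (P j) →
      z ∈ segment ℝ (P i') (P j') → ∃ c, (c = i ∨ c = j) ∧ (c = i' ∨ c = j') ∧ z = P c := by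
    intro i j i' j' hij hij' hji hz hz'
    obtain ⟨h1, h2⟩ := eq_of_mem_segment_of_separated (α := 1) (β := 0) (c := X i')
      (by simpa [P1] using hX.monotone hji) (by simpa [P1] using hX (hij.trans_le hji))
      (by simp [P1]) (by simpa [P1] using hX.monotone hij'.le) ((segment_symm ℝ _ _).subset hz) hz'
    have : X j = X i' := by simpa [P1] using h2
    exact ⟨j, Or.inr rfl, Or.inl (hX.injective this), h1⟩
  -- the line through the upper long edge
  set α := M - Y (a + 1) with hα
  have hα0 : 0 ≤ α ∧ α ≤ M - m := by
    have := hY (a + 1) (by omega)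
    exact ⟨by linarith [this.2], by linarith [this.1]⟩
  have top0 : α * (P 0).1 + X (a + 1) * (P 0).2 = X (a + 1) * M := by
    rw [P1, P2, Xl 0 (Nat.zero_le a), h0]; simp
  have top1 : α * (P (a + 1)).1 + X (a + 1) * (P (a + 1)).2 = X (a + 1) * M := by
    rw [P1, P2, hα]; ring
  have hXa : X (a + 1) = (a : ℝ) + 1 + (M - m) * n := by rw [Xr _ (by omega)]; push_cast; ring
  have hXa0 : 0 < X (a + 1) := by rw [hXa]; positivity
  -- Over the left path the line drops by `α * i / X (a + 1) < 1`, because the gap is at least `α *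
  -- i`; the left vertices are at least `1` below `M`.
  have topl : ∀ i, 0 < i → i ≤ a → α * (P i).1 + X (a + 1) * (P i).2 < X (a + 1) * M := by
    intro i hi hia
    rw [P1, P2, Xl i hia]
    have e1 := mul_le_mul_of_nonneg_left (hleft i hi hia) hXa0.le
    have e2 : α * (i : ℝ) ≤ (M - m) * i := mul_le_mul_of_nonneg_right hα0.2 (by positivity)
    have e3 := hbound i (by omega)
    have e4 : (M - m) * n < X (a + 1) := by rw [hXa]; linarith [(Nat.cast_nonneg a : (0 : ℝ) ≤ a)]
    linarith
  -- Prolonged to the last abscissa, the line drops by less than `1` below `Y (a + 1) ≥ m + 1`, so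
  -- it is still above the bottom level.
  have topr : ∀ l, l + 1 = n → a + 1 < l →
      α * (P l).1 + X (a + 1) * (P l).2 < X (a + 1) * M := by
    intro l hl hal
    rw [P1, P2, hlast l hl]
    have e1 := mul_le_mul_of_nonneg_left (hright (a + 1) (by omega) (by omega)) hXa0.le
    obtain ⟨d, rfl⟩ := Nat.exists_eq_add_of_lt hal
    have e2 : α * (d + 1) ≤ (M - m) * (d + 1) := mul_le_mul_of_nonneg_right hα0.2 (by positivity)
    have e3 := hbound (d + 1) (by omega)
    have e4 : (M - m) * n < X (a + 1) := by rw [hXa]; linarith [(Nat.cast_nonneg a : (0 : ℝ) ≤ a)]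
    have e5 : X (a + 1 + d + 1) = X (a + 1) + (d + 1) := by
      rw [Xr _ (by omega), Xr _ (by omega)]; push_cast; ring
    rw [e5]
    have e6 : X (a + 1) * Y (a + 1) = X (a + 1) * M - X (a + 1) * α := by rw [hα]; ring
    push_cast at e3
    linarith
  -- the upper long edge and the left path
  have top_left : ∀ {i}, i < a → z ∈ segment ℝ (P 0) (P (a + 1)) →
      z ∈ segment ℝ (P i) (P (i + 1)) → i = 0 ∧ z = P 0 := by
    intro i hia hz hz'
    have hPi : α * (P i).1 + X (a + 1) * (P i).2 ≤ X (a + 1) * M := by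
      rcases Nat.eq_zero_or_pos i with rfl | hi
      · exact top0.le
      · exact (topl i hi hia.le).le
    obtain ⟨h1, h2⟩ := eq_of_mem_segment_of_separated hPi (topl (i + 1) (by omega) (by omega))
      top0.ge top1.ge hz' hz
    obtain rfl : i = 0 := by
      by_contra hi
      exact (topl i (Nat.pos_of_ne_zero hi) hia.le).ne h2
    exact ⟨rfl, h1⟩
  -- the two long edges
  have top_bot : ∀ {l}, l + 1 = n → z ∈ segment ℝ (P 0) (P (a + 1)) →
      z ∈ segment ℝ (P a) (P l) → (a = 0 ∧ z = P 0) ∨ (l = a + 1 ∧ z = P l) := by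
    intro l hl hz hz'
    -- The long edges share an endpoint exactly when one of the two paths is a single vertex.
    rcases Nat.eq_zero_or_pos a with rfl | ha0
    · exact Or.inl ⟨rfl, (eq_of_mem_segment_of_separated top0.le (topr l hl (by omega))
        top0.ge top1.ge hz' hz).1⟩
    · rcases (by omega : l = a + 1 ∨ a + 1 < l) with rfl | hal
      · exact Or.inr ⟨rfl, (eq_of_mem_segment_of_separated top1.le (topl a ha0 le_rfl)
          top0.ge top1.ge ((segment_symm ℝ _ _).subset hz') hz).1⟩
      · have h := (eq_of_mem_segment_of_separated (topl a ha0 le_rfl).le (topr l hl hal)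
          top0.ge top1.ge hz' hz).2
        exact absurd h (topl a ha0 le_rfl).ne
  -- the lower long edge and the right path
  have bot_right : ∀ {i l}, l + 1 = n → a < i → i < l → z ∈ segment ℝ (P a) (P l) →
      z ∈ segment ℝ (P i) (P (i + 1)) → i + 1 = l ∧ z = P l := by
    intro i l hl hai hil hz hz'
    set β := Y a - m with hβ
    have hβ0 : 0 ≤ β ∧ β ≤ M - m := by
      have := hY a (by omega)
      exact ⟨by linarith [this.1], by linarith [this.2]⟩
    set L := X l - X a with hL
    have hL0 : (M - m) * n < L := by
      rw [hL, Xr l (by omega), Xl a le_rfl]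
      have : (a : ℝ) < l := by exact_mod_cast hai.trans hil
      linarith
    -- The signs are reversed since the right path lies above the line through the lower long edge.
    set c := -(β * X l + L * m) with hc
    have bota : (-β) * (P a).1 + (-L) * (P a).2 = c := by rw [P1, P2, hc, hL, hβ]; ring
    have botl : (-β) * (P l).1 + (-L) * (P l).2 = c := by rw [P1, P2, hc, hlast l hl]; ring
    have bot : ∀ i, a < i → i < l → (-β) * (P i).1 + (-L) * (P i).2 < c := by
      intro i hai hil
      rw [P1, P2, hc]
      have e1 := mul_le_mul_of_nonneg_left (hright i hai (by omega)) (hK.trans hL0.le)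
      obtain ⟨d, rfl⟩ := Nat.exists_eq_add_of_lt hil
      have e5 : X (i + d + 1) = X i + (d + 1) := by
        rw [Xr _ (by omega), Xr _ (by omega)]; push_cast; ring
      have e2 : β * (d + 1) ≤ (M - m) * (d + 1) := mul_le_mul_of_nonneg_right hβ0.2 (by positivity)
      have e3 := hbound (d + 1) (by omega)
      rw [e5]
      push_cast at e3
      linarith
    have hPi : (-β) * (P (i + 1)).1 + (-L) * (P (i + 1)).2 ≤ c := by
      rcases (by omega : i + 1 = l ∨ i + 1 < l) with h | h
      · rw [h]; exact botl.le
      · exact (bot (i + 1) (by omega) h).le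
    obtain ⟨h1, h2⟩ := eq_of_mem_segment_of_separated hPi (bot i hai hil) bota.ge botl.ge
      ((segment_symm ℝ _ _).subset hz') hz
    obtain rfl : i + 1 = l := by
      by_contra hi
      exact (bot (i + 1) (by omega) (by omega)).ne h2
    exact ⟨rfl, h1⟩
  have hij := lt_of_edge he
  have hij' := lt_of_edge he'
  rcases le_or_gt j i' with h | hji
  · exact apart hij hij' h hz hz'
  rcases le_or_gt j' i with h | hji'
  · obtain ⟨c, h1, h2, h3⟩ := apart hij' hij h hz' hz
    exact ⟨c, h2, h1, h3⟩
  -- The index ranges now overlap: two short edges must coincide, and a short edge meeting the range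
  -- of the upper (lower) long edge belongs to the left (right) path.
  rcases he with ⟨rfl, hjn, hia⟩ | ⟨rfl, rfl⟩ | ⟨rfl, hjn⟩ <;>
    rcases he' with ⟨rfl, hjn', hia'⟩ | ⟨rfl, rfl⟩ | ⟨rfl, hjn'⟩
  · exact absurd (by rw [Prod.mk.injEq]; omega) hne
  · obtain ⟨rfl, h⟩ := top_left (by omega) hz' hz
    exact ⟨0, Or.inl rfl, Or.inl rfl, h⟩
  · obtain ⟨rfl, h⟩ := bot_right hjn' (by omega) (by omega) hz' hz
    exact ⟨_, Or.inr rfl, Or.inr rfl, h⟩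
  · obtain ⟨rfl, h⟩ := top_left (by omega) hz hz'
    exact ⟨0, Or.inl rfl, Or.inl rfl, h⟩
  · exact absurd rfl hne
  · rcases top_bot hjn' hz hz' with ⟨rfl, h⟩ | ⟨rfl, h⟩
    · exact ⟨0, Or.inl rfl, Or.inl rfl, h⟩
    · exact ⟨_, Or.inr rfl, Or.inr rfl, h⟩
  · obtain ⟨rfl, h⟩ := bot_right hjn (by omega) (by omega) hz hz'
    exact ⟨_, Or.inr rfl, Or.inr rfl, h⟩
  · rcases top_bot hjn hz' hz with ⟨rfl, h⟩ | ⟨rfl, h⟩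
    · exact ⟨0, Or.inl rfl, Or.inl rfl, h⟩
    · exact ⟨_, Or.inr rfl, Or.inr rfl, h⟩
  · exact absurd (by rw [Prod.mk.injEq]; omega) hne

/-- The edges of an enumerated cycle, cut behind its first vertex and behind `v k` into two paths,
both of which are then listed from the first vertex towards `v k`. -/
theorem IsCyclicEnumeration.exists_two_paths {V : Type*} {H : SimpleGraph V} {n : ℕ} {v : ℕ → V}
    (hv : IsCyclicEnumeration H n v) {k a : ℕ} (hk : 0 < k) (hkn : k + a + 1 = n) :
    ∃ u : ℕ → V, (∀ i ≤ a, u i = v (n - i)) ∧ (∀ i, a < i → u i = v (i - a)) ∧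
      (∀ i < n, ∀ j < n, u i = u j → i = j) ∧ (∀ x, ∃ i < n, u i = x) ∧
      ∀ x y, H.Adj x y → ∃ i j, IsTwoPathEdge n a i j ∧ s(x, y) = s(u i, u j) := by
  -- The left path is `v n = v 0, v (n - 1), …, v (k + 1)`, the right one `v 1, …, v k`.
  let u : ℕ → V := fun i => if i ≤ a then v (n - i) else v (i - a)
  have ul : ∀ i ≤ a, u i = v (n - i) := fun i hi => if_pos hi
  have ur : ∀ i, a < i → u i = v (i - a) := fun i hi => if_neg (by omega)
  have u0 : u 0 = v 0 := by rw [ul 0 (Nat.zero_le a), Nat.sub_zero, hv.apply_card]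
  have hvinj : ∀ {i j}, 0 < i → i ≤ n → 0 < j → j ≤ n → v i = v j → i = j := by
    intro i j _ _ _ _ h
    rcases lt_trichotomy i j with hij | hij | hij
    · exact absurd h (hv.ne_of_lt hij (by omega))
    · exact hij
    · exact absurd h.symm (hv.ne_of_lt hij (by omega))
  refine ⟨u, ul, ur, fun i hi j hj h => ?_, fun x => ?_, fun x y hxy => ?_⟩
  · rcases le_or_gt i a with hia | hia <;> rcases le_or_gt j a with hja | hja
    · rw [ul i hia, ul j hja] at h
      have := hvinj (by omega) (by omega) (by omega) (by omega) h
      omega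
    · rw [ul i hia, ur j hja] at h
      have := hvinj (by omega) (by omega) (by omega) (by omega) h
      omega
    · rw [ur i hia, ul j hja] at h
      have := hvinj (by omega) (by omega) (by omega) (by omega) h
      omega
    · rw [ur i hia, ur j hja] at h
      have := hvinj (by omega) (by omega) (by omega) (by omega) h
      omega
  · obtain ⟨l, hl, rfl⟩ := hv.exists_lt (by omega) x
    rcases Nat.eq_zero_or_pos l with rfl | hl0
    · exact ⟨0, by omega, u0⟩
    rcases le_or_gt l k with hlk | hlk
    · exact ⟨l + a, by omega, by rw [ur _ (by omega), Nat.add_sub_cancel]⟩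
    · exact ⟨n - l, by omega, by rw [ul _ (by omega), Nat.sub_sub_self hl.le]⟩
  · obtain ⟨l, hl, hxl⟩ := hv.exists_lt_of_adj (by omega) hxy
    rw [hxl]
    rcases Nat.eq_zero_or_pos l with rfl | hl0
    · exact ⟨0, a + 1, Or.inr (Or.inl ⟨rfl, rfl⟩), by rw [u0, ur _ (by omega)]; simp⟩
    rcases lt_trichotomy l k with hlk | rfl | hlk
    · refine ⟨l + a, l + a + 1, Or.inl ⟨rfl, by omega, by omega⟩, ?_⟩
      rw [ur _ (by omega), ur _ (by omega), Nat.add_sub_cancel, add_right_comm,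
        Nat.add_sub_cancel]
    · refine ⟨a, l + a, Or.inr (Or.inr ⟨rfl, hkn⟩), ?_⟩
      rw [ul _ le_rfl, ur _ (by omega), Nat.add_sub_cancel, (by omega : n - a = l + 1)]
      exact Sym2.eq_swap
    · refine ⟨n - (l + 1), n - l, Or.inl ⟨by omega, by omega, by omega⟩, ?_⟩
      rw [ul _ (by omega), ul _ (by omega), Nat.sub_sub_self hl, Nat.sub_sub_self hl.le]
      exact Sym2.eq_swap

theorem isLevelPlanar_of_maximalSinksConsecutive {V : Type*} {G : Digraph V} {γ : V → ℤ}
    (hG : IsOrientedCycle G) (hγ : IsLevelAssignment G γ) (hT : MaximalSinksConsecutive G γ) :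
    IsLevelPlanar G γ := by
  obtain ⟨-, n, hn, ⟨e⟩⟩ := hG
  obtain ⟨v', hv'⟩ := exists_isCyclicEnumeration (by omega) e
  -- Extreme levels force sources and sinks, so a vertex outside `minimalSources` or `maximalSinks`
  -- is off the extreme level, by at least `1` since levels are integers.
  have source_of_min : ∀ x, (∀ y, γ x ≤ γ y) → x ∈ minimalSources G γ := fun x hx =>
    ⟨fun y h => (hγ y x h).not_ge (hx y), hx⟩
  have sink_of_max : ∀ x, (∀ y, γ y ≤ γ x) → x ∈ maximalSinks G γ := fun x hx =>
    ⟨fun y h => (hγ x y h).not_ge (hx y), hx⟩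
  have hSne : (minimalSources G γ).Nonempty := by
    obtain ⟨i, -, hi⟩ := (Finset.range n).exists_min_image (fun i => γ (v' i)) ⟨0, by simp; omega⟩
    refine ⟨v' i, source_of_min _ fun y => ?_⟩
    obtain ⟨j, hj, rfl⟩ := hv'.exists_lt (by omega) y
    exact hi j (Finset.mem_range.2 hj)
  have hTne : (maximalSinks G γ).Nonempty := by
    obtain ⟨i, -, hi⟩ := (Finset.range n).exists_max_image (fun i => γ (v' i)) ⟨0, by simp; omega⟩
    refine ⟨v' i, sink_of_max _ fun y => ?_⟩
    obtain ⟨j, hj, rfl⟩ := hv'.exists_lt (by omega) y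
    exact hi j (Finset.mem_range.2 hj)
  obtain ⟨v, k, hv, hk, hkn, hv0, hvk, hS, hT'⟩ := hv'.exists_split (by omega) hSne hTne
    (fun x hx hx' => by
      obtain ⟨p, hp⟩ := hT x hx x hx
      exact hp x p.start_mem_support hx') hT
  obtain ⟨a, ha⟩ : ∃ a, k + a + 1 = n := ⟨n - k - 1, by omega⟩
  obtain ⟨u, ul, ur, uinj, usurj, uadj⟩ := hv.exists_two_paths hk ha
  choose idx hidx uidx using usurj
  have idx_u : ∀ i < n, idx (u i) = i := fun i hi => uinj _ (hidx _) _ hi (uidx _)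
  have u0 : u 0 = v 0 := by rw [ul 0 (Nat.zero_le a), Nat.sub_zero, hv.apply_card]
  set m : ℝ := (γ (v k) : ℝ) with hm
  set M : ℝ := (γ (v 0) : ℝ) with hM
  let P : ℕ → ℝ × ℝ := fun i => (gapAbscissa a ((M - m) * n) i, (γ (u i) : ℝ))
  have hmM : 0 ≤ M - m := sub_nonneg.2 (Int.cast_le.2 (hvk.2 (v 0)))
  have hX := gapAbscissa_strictMono a (K := (M - m) * n) (by positivity)
  have edge_lt : ∀ {i j}, IsTwoPathEdge n a i j → i < n ∧ j < n := by
    rintro i j (h | h | h) <;> omega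
  refine isLevelPlanar_of_segments hγ (fun x => ?_) (fun x => P (idx x)) (fun x y hxy => ?_)
    (fun x => by simp only [P, uidx]) ?_
  · obtain ⟨i, rfl⟩ := hv.surjective x
    exact ⟨_, hv.adj_succ i⟩
  · have := hX.injective (congrArg Prod.fst hxy)
    rw [← uidx x, ← uidx y, this]
  · intro x y x' y' hxy hxy' hne z hz hz'
    obtain ⟨i, j, hij, he⟩ := uadj x y hxy
    obtain ⟨i', j', hij', he'⟩ := uadj x' y' hxy'
    have hseg : ∀ {x y : V} {i j : ℕ}, IsTwoPathEdge n a i j → s(x, y) = s(u i, u j) →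
        z ∈ segment ℝ (P (idx x)) (P (idx y)) → z ∈ segment ℝ (P i) (P j) := by
      intro x y i j hij he hz
      rcases Sym2.eq_iff.1 he with ⟨rfl, rfl⟩ | ⟨rfl, rfl⟩
      · rwa [idx_u _ (edge_lt hij).1, idx_u _ (edge_lt hij).2] at hz
      · rwa [idx_u _ (edge_lt hij).1, idx_u _ (edge_lt hij).2, segment_symm] at hz
    obtain ⟨c, hc, hc', hzc⟩ := exists_common_endpoint (Y := fun i => (γ (u i) : ℝ)) (m := m)
      (M := M) (P := P) hn (by omega)
      (fun i _ => ⟨Int.cast_le.2 (hvk.2 _), Int.cast_le.2 (hv0.2 _)⟩) (by rw [u0])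
      (fun i hi => by rw [ur i (by omega), (by omega : i - a = k)])
      (fun i hi hia => by
        have hlt : γ (u i) < γ (v 0) := by
          refine lt_of_le_of_ne (hv0.2 _) fun heq => ?_
          refine hT' (n - i) (by omega) (by omega) ?_
          rw [← ul i hia]
          exact sink_of_max _ fun y => heq ▸ hv0.2 y
        have : γ (u i) + 1 ≤ γ (v 0) := hlt
        have : (γ (u i) : ℝ) + 1 ≤ γ (v 0) := by exact_mod_cast this
        exact le_sub_iff_add_le.2 this)
      (fun i hai hin => by
        have hlt : γ (v k) < γ (u i) := by
          refine lt_of_le_of_ne (hvk.2 _) fun heq => ?_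
          refine hS (i - a) (by omega) ?_
          rw [← ur i hai]
          exact source_of_min _ fun y => heq ▸ hvk.2 y
        have : γ (v k) + 1 ≤ γ (u i) := hlt
        have : (γ (v k) : ℝ) + 1 ≤ γ (u i) := by exact_mod_cast this
        exact this)
      (fun i => rfl) hij hij'
      (fun h => by
        rw [Prod.mk.injEq] at h
        rw [he, he', h.1, h.2] at hne
        exact hne rfl)
      (hseg hij he hz) (hseg hij' he' hz')
    have hcn : c < n := by rcases hc with rfl | rfl <;> [exact (edge_lt hij).1; exact (edge_lt hij).2]
    refine ⟨u c, ?_, ?_, by rw [hzc, idx_u c hcn]⟩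
    · rw [← Sym2.mem_iff, he, Sym2.mem_iff]
      exact hc.imp (congrArg u) (congrArg u)
    · rw [← Sym2.mem_iff, he', Sym2.mem_iff]
      exact hc'.imp (congrArg u) (congrArg u)

theorem mainTheorem6 {V : Type*} (G : Digraph V) (γ : V → ℤ)
    (hG : IsOrientedCycle G) (hγ : IsLevelAssignment G γ) :
    IsLevelPlanar G γ ↔ MaximalSinksConsecutive G γ :=
  ⟨maximalSinksConsecutive_of_isLevelPlanar hG, isLevelPlanar_of_maximalSinksConsecutive hG hγ⟩
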